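/- Let $Y$ be a metrizable abelian topological group and let $X$ be a $Y$-Tychonoff topological space, i.e. for every closed $A\subseteq X$, every point $y_0\in Y$ and every function $f:F\to Y$ on a finite set $F\subseteq X\setminus A$ there is a continuous $\bar f:X\to Y$ with $\bar f|_F=f$ and $\bar f(A)\subseteq\{y_0\}$. Endow $Y^X$ with the topology of pointwise convergence (the product topology) and its subsets with the subspace topology. Let $B_1^{st}(X,Y)$ be the set of all $f\in Y^X$ for which there is a sequence $(f_n)$ of continuous functions $X\to Y$ such that for every $x\in X$ the set $\{n: f_n(x)\neq f(x)\}$ is finite. Let $B_0(X,Y)$ be the set of continuous functions $X\to Y$ and, for every nonzero countable ordinal $\alpha$, let $B_\alpha(X,Y)$ be the set of all pointwise limits of sequences from $\bigcup_{\beta<\alpha}B_\beta(X,Y)$. (i) Every subgroup $H$ of $Y^X$ with $B_1^{st}(X,Y)\subseteq H$ is $\kappa$-Fréchet–Urysohn (for every open $U\subseteq H$ and every $h\in\overline{U}$ there is a sequence in $U$ converging to $h$), and it is an Ascoli space ($H$ is Tychonoff, and for every compact subset $K$ of the space $C(H,\mathbb R)$ with the compact-open topology the evaluation map $H\times K\to\mathbb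 R$, $(h,\varphi)\mapsto\varphi(h)$, is continuous). (ii) In particular, for every countable ordinal $\alpha\ge 1$ the space $B_\alpha(X,Y)$ is $\kappa$-Fréchet–Urysohn and Ascoli. -/

import Mathlib

open Topology

/-- `X` is `Y`-Tychonoff: for every closed `A ⊆ X`, every `y₀ : Y` and every function `f : F → Y` on
a finite set `F ⊆ X \ A` there is a continuous `g : X → Y` that extends `f` and is constantly `y₀`
on `A`. -/
def IsYTychonoff (X : Type*) (Y : Type*) [TopologicalSpace X] [TopologicalSpace Y] : Prop :=
  ∀ (A : Set X), IsClosed A → ∀ (y₀ : Y) (F : Set X), F.Finite → F ⊆ Aᶜ → ∀ f : F → Y,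
    ∃ g : X → Y, Continuous g ∧ (∀ x : F, g x = f x) ∧ ∀ x ∈ A, g x = y₀

/-- The sequence `u` of functions converges stably to `f`: at every point `x`, `u n x = f x` for all
but finitely many `n`. -/
def StablyConverges {X : Type*} {Y : Type*} (u : ℕ → X → Y) (f : X → Y) : Prop :=
  ∀ x : X, {n : ℕ | u n x ≠ f x}.Finite

/-- The stable Baire-1 functions `X → Y`: the stable limits of sequences of continuous functions. -/
def stableBaireOne (X : Type*) (Y : Type*) [TopologicalSpace X] [TopologicalSpace Y] :
    Set (X → Y) :=
  {f | ∃ u : ℕ → X → Y, (∀ n, Continuous (u n)) ∧ StablyConverges u f}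

/-- The Baire class of order `α`: the continuous functions for `α = 0`; for `α ≠ 0` the pointwise
limits of sequences of functions each of which is in the Baire class of some order `β < α`. -/
def baireClass (X : Type*) (Y : Type*) [TopologicalSpace X] [TopologicalSpace Y]
    (α : Ordinal.{0}) : Set (X → Y) :=
  {f | (α = 0 ∧ Continuous f) ∨
    (α ≠ 0 ∧ ∃ u : ℕ → X → Y, (∀ n, ∃ β : Ordinal.{0}, ∃ _ : β < α, u n ∈ baireClass X Y β) ∧
      ∀ x : X, Filter.Tendsto (fun n => u n x) Filter.atTop (𝓝 (f x)))}
termination_by α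

/-- `E` is κ-Fréchet–Urysohn: every point in the closure of an open set `U` is the limit of a
sequence of points of `U`. -/
def IsKappaFrechetUrysohn (E : Type*) [TopologicalSpace E] : Prop :=
  ∀ U : Set E, IsOpen U → ∀ x ∈ closure U,
    ∃ u : ℕ → E, (∀ n, u n ∈ U) ∧ Filter.Tendsto u Filter.atTop (𝓝 x)

/-- `E` is an Ascoli space: it is Tychonoff, and every compact subset `K` of `C(E, ℝ)` with the
compact-open topology is evenly continuous, that is, evaluation `E × K → ℝ` is continuous. -/
def IsAscoli (E : Type*) [TopologicalSpace E] : Prop :=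
  T35Space E ∧ ∀ K : Set C(E, ℝ), IsCompact K →
    Continuous (fun p : E × K => (p.2 : C(E, ℝ)) p.1)

/-! Let `h` lie in the closure of an open `U ⊆ H`. Choose `g n ∈ U` close to `h` on a finite set `F
n`, and then a larger finite set `F (n + 1)` such that every member of `H` agreeing with `g n` there
is in `U`. It remains to correct `h` to the values of `g n` on `F (n + 1)` without leaving `H` or
losing convergence elsewhere. The points of all `F n` form a countable set, so they have pairwise
disjoint Gδ sets `G x` around them, independent of `n`. The correction is a finite sum of stable
Baire-1 functions, the one at `x` being constant on a part of `G x` and zero off it. Hence any `z`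
sees at most one point `x`, and the correction at `z` is `0` or `(g n) x - h x`, which tends to `0`.

The Ascoli property follows from the κ-Fréchet–Urysohn one, and Baire classes are subgroups
containing the stable Baire-1 functions. -/

open Filter Set

/-- At a point of equicontinuity one compares values along the compact set formed by a convergent
sequence and its limit. -/
theorem IsKappaFrechetUrysohn.isAscoli {E : Type*} [TopologicalSpace E] [T35Space E]
    (hE : IsKappaFrechetUrysohn E) : IsAscoli E := by
  refine ⟨inferInstance, fun K hK => ?_⟩
  have key : ∀ x₀ : E, ∀ ε > 0, ∀ᶠ x in 𝓝 x₀, ∀ φ ∈ K, dist (φ x) (φ x₀) ≤ ε := by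
    intro x₀ ε hε
    by_contra hcon
    -- Failure of equicontinuity at `x₀` puts `x₀` in the closure of this open set, so a sequence in
    -- it converges to `x₀`.
    let U : Set E := {x | ∃ φ ∈ K, ε < dist (φ x) (φ x₀)}
    have hU : IsOpen U := by
      have : U = ⋃ φ ∈ K, {x | ε < dist (φ x) (φ x₀)} := by ext; simp [U]
      rw [this]
      exact isOpen_biUnion fun φ _ => isOpen_lt continuous_const (by fun_prop)
    have hx₀ : x₀ ∈ closure U := by
      rw [mem_closure_iff_frequently]
      intro h
      exact hcon (h.mono fun x hx φ hφ => not_lt.1 fun hlt => hx ⟨φ, hφ, hlt⟩)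
    obtain ⟨u, huU, hu⟩ := hE U hU x₀ hx₀
    let S : Set E := insert x₀ (range u)
    have hS : CompactSpace S := isCompact_iff_compactSpace.1 hu.isCompact_insert_range
    let s₀ : S := ⟨x₀, mem_insert _ _⟩
    let s : ℕ → S := fun n => ⟨u n, mem_insert_of_mem _ ⟨n, rfl⟩⟩
    have hs : Tendsto s atTop (𝓝 s₀) := tendsto_subtype_rng.2 hu
    have hcont : Continuous fun p : C(E, ℝ) × S => dist (p.1 p.2) (p.1 x₀) := by
      have h1 : Continuous fun p : C(E, ℝ) × S => (p.1.restrict S) p.2 :=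
        ((ContinuousMap.continuous_restrict S).comp continuous_fst).eval continuous_snd
      exact h1.dist ((ContinuousEvalConst.continuous_eval_const x₀).comp continuous_fst)
    -- Compactness of `K` makes the bound uniform in `φ`, so the witness in `K` may vary along the
    -- sequence.
    have hev : ∀ᶠ t : S in 𝓝 s₀, ∀ φ ∈ K, dist (φ t.1) (φ x₀) < ε := by
      refine hK.eventually_forall_of_forall_eventually fun φ _ => ?_
      refine (hcont.comp continuous_swap).continuousAt.eventually_lt continuousAt_const ?_
      simpa [s₀] using hε
    obtain ⟨n, hn⟩ := (hs.eventually hev).exists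
    obtain ⟨φ, hφ, hlt⟩ := huU n
    exact lt_asymm hlt (hn φ hφ)
  rw [continuous_iff_continuousAt]
  rintro ⟨x₀, φ₀⟩
  rw [ContinuousAt, Metric.tendsto_nhds]
  intro ε hε
  have h1 : ∀ᶠ p : E × K in 𝓝 (x₀, φ₀), ∀ φ ∈ K, dist (φ p.1) (φ x₀) ≤ ε / 2 :=
    (continuous_fst.tendsto (x₀, φ₀)).eventually (key x₀ (ε / 2) (half_pos hε))
  have h2 : ∀ᶠ p : E × K in 𝓝 (x₀, φ₀),
      dist ((p.2 : C(E, ℝ)) x₀) ((φ₀ : C(E, ℝ)) x₀) < ε / 2 := by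
    have hc : Continuous fun p : E × K => (p.2 : C(E, ℝ)) x₀ :=
      (ContinuousEvalConst.continuous_eval_const x₀).comp
        (continuous_subtype_val.comp continuous_snd)
    exact (Metric.tendsto_nhds.1 (hc.tendsto (x₀, φ₀))) _ (half_pos hε)
  filter_upwards [h1, h2] with p hp1 hp2
  calc dist ((p.2 : C(E, ℝ)) p.1) ((φ₀ : C(E, ℝ)) x₀)
      ≤ dist ((p.2 : C(E, ℝ)) p.1) ((p.2 : C(E, ℝ)) x₀)
        + dist ((p.2 : C(E, ℝ)) x₀) ((φ₀ : C(E, ℝ)) x₀) := dist_triangle _ _ _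
    _ < ε := by linarith [hp1 p.2 p.2.2]

theorem IsYTychonoff.t2Space {X Y : Type*} [TopologicalSpace X] [TopologicalSpace Y] [T2Space Y]
    [Nontrivial Y] (hX : IsYTychonoff X Y) : T2Space X := by
  classical
  refine ⟨fun a b hab => ?_⟩
  obtain ⟨y₁, y₂, hy⟩ := exists_pair_ne Y
  obtain ⟨g, hg, hgF, -⟩ := hX ∅ isClosed_empty y₁ {a, b} (by simp) (by simp)
    (fun x => if (x : X) = a then y₁ else y₂)
  have ha : g a = y₁ := by simpa using hgF ⟨a, by simp⟩
  have hb : g b = y₂ := by simpa [hab.symm] using hgF ⟨b, by simp⟩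
  exact separated_by_continuous hg (by rwa [ha, hb])

/-- Every point of a `Gδ` set lies in a smaller set `Z` such that the function with constant value
`y` on `Z` and `0` elsewhere is stable Baire-1. -/
theorem IsYTychonoff.exists_indicator_mem_stableBaireOne {X Y : Type*} [TopologicalSpace X]
    [Zero Y] [TopologicalSpace Y] [TopologicalSpace.MetrizableSpace Y] (hX : IsYTychonoff X Y)
    {G : Set X} (hG : IsGδ G) {x : X} (hx : x ∈ G) (y : Y) :
    ∃ Z ⊆ G, x ∈ Z ∧ Z.indicator (fun _ => y) ∈ stableBaireOne X Y := by
  let := TopologicalSpace.metrizableSpaceMetric Y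
  obtain ⟨O, hO, rfl⟩ := isGδ_iff_eq_iInter_nat.1 hG
  rw [mem_iInter] at hx
  have hbump : ∀ V : Set X, IsOpen V → x ∈ V →
      ∃ g : X → Y, Continuous g ∧ g x = y ∧ ∀ z ∉ V, g z = 0 := by
    intro V hV hxV
    obtain ⟨g, hg, hgF, hgA⟩ := hX Vᶜ hV.isClosed_compl 0 {x} (finite_singleton x)
      (by simpa using hxV) (fun _ => y)
    exact ⟨g, hg, hgF ⟨x, rfl⟩, fun z hz => hgA z hz⟩
  -- Here `s` records past deviations from `y`. A point that has once deviated keeps `s` above a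
  -- positive constant, so the threshold `1 / (n + 1)` eventually forces the value `0` there; points
  -- that never deviate and lie in every `O i` make up `Z`.
  have hstep : ∀ (n : ℕ) (s : {s : X → ℝ // Continuous s ∧ s x = 0}),
      ∃ g : X → Y, Continuous g ∧ g x = y ∧
        ∀ z, g z ≠ 0 → s.1 z < 1 / ((n : ℝ) + 1) ∧ ∀ i ≤ n, z ∈ O i := by
    rintro n ⟨s, hs, hsx⟩
    obtain ⟨g, hg, hgx, hgV⟩ := hbump ({z | s z < 1 / ((n : ℝ) + 1)} ∩ ⋂ i ∈ Iic n, O i)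
      ((isOpen_lt hs continuous_const).inter
        ((finite_Iic n).isOpen_biInter fun i _ => hO i))
      ⟨by simp only [mem_ofPred_eq, hsx]; positivity, by simpa using fun i _ => hx i⟩
    refine ⟨g, hg, hgx, fun z hz => ?_⟩
    have := not_imp_comm.1 (hgV z) hz
    simpa using this
  choose g hgc hgx hgV using hstep
  -- the partial sums of the distances of the approximations to `y`
  let s : ℕ → {s : X → ℝ // Continuous s ∧ s x = 0} := fun n =>
    Nat.rec ⟨fun _ => 0, continuous_const, rfl⟩
      (fun n s => ⟨fun z => s.1 z + dist (g n s z) y,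
        s.2.1.add ((hgc n s).dist continuous_const), by simp [s.2.2, hgx]⟩) n
  let k : ℕ → X → Y := fun n => g n (s n)
  have hsucc : ∀ n z, (s (n + 1)).1 z = (s n).1 z + dist (k n z) y := fun n z => rfl
  have hmono : ∀ z, Monotone fun n => (s n).1 z := fun z =>
    monotone_nat_of_le_succ fun n => by
      simp only [hsucc]; exact le_add_of_nonneg_right dist_nonneg
  have hnonneg : ∀ n z, 0 ≤ (s n).1 z := fun n z => hmono z (Nat.zero_le n)
  refine ⟨{z | ∀ n, z ∈ O n ∧ k n z = y}, fun z hz => mem_iInter.2 fun n => (hz n).1,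
    fun n => ⟨hx n, hgx n _⟩, k, fun n => hgc n _, fun z => ?_⟩
  by_cases hz : ∀ n, z ∈ O n ∧ k n z = y
  · have hzero : {n | k n z ≠
        ({z | ∀ n, z ∈ O n ∧ k n z = y} : Set X).indicator (fun _ => y) z} = ∅ := by
      refine eq_empty_of_forall_notMem fun n hn => hn ?_
      rw [indicator_of_mem (by exact hz), (hz n).2]
    rw [hzero]
    exact finite_empty
  · rw [indicator_of_notMem (by exact hz)]
    push Not at hz
    obtain ⟨i, hi⟩ := hz
    by_cases hzO : z ∈ O i
    · have hpos : 0 < dist (k i z) y := dist_pos.2 (hi hzO)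
      obtain ⟨N, hN⟩ := exists_nat_one_div_lt hpos
      refine (finite_lt_nat (max (i + 1) N)).subset fun n hn => ?_
      by_contra (hlt : ¬ n < max (i + 1) N)
      obtain ⟨h1, h2⟩ := max_le_iff.1 (not_lt.1 hlt)
      have h3 := (hgV n (s n) z hn).1
      have h4 : (s (i + 1)).1 z ≤ (s n).1 z := hmono z h1
      have h5 : 1 / ((n : ℝ) + 1) ≤ 1 / ((N : ℝ) + 1) := Nat.one_div_le_one_div h2
      linarith [hsucc i z, hnonneg i z]
    · refine (finite_lt_nat i).subset fun n hn => ?_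
      by_contra (hlt : ¬ n < i)
      exact hzO ((hgV n (s n) z hn).2 i (not_lt.1 hlt))

theorem exists_finset_forall_eqOn_mem {X Y : Type*} [TopologicalSpace Y] {H : Set (X → Y)}
    {U : Set H} (hU : IsOpen U) {g : H} (hg : g ∈ U) :
    ∃ F : Finset X, ∀ g' : H, EqOn g'.1 g.1 F → g' ∈ U := by
  obtain ⟨W, hW, rfl⟩ := isOpen_induced_iff.1 hU
  obtain ⟨F, u, hu, hFW⟩ := isOpen_pi_iff.1 hW g.1 hg
  exact ⟨F, fun g' hg' => hFW fun x hx => by rw [hg' hx]; exact (hu x hx).2⟩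

theorem exists_mem_forall_dist_lt {X Y : Type*} [PseudoMetricSpace Y] {H : Set (X → Y)}
    {U : Set H} {h : H} (hh : h ∈ closure U) (F : Finset X) {ε : ℝ} (hε : 0 < ε) :
    ∃ g ∈ U, ∀ x ∈ F, dist (g.1 x) (h.1 x) < ε := by
  have : ∀ᶠ g : H in 𝓝 h, ∀ x ∈ F, dist (g.1 x) (h.1 x) < ε := by
    rw [Filter.eventually_all_finset]
    intro x _
    have hc : Continuous fun g : H => g.1 x := (continuous_apply x).comp continuous_subtype_val
    exact Metric.tendsto_nhds.1 (hc.tendsto h) ε hε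
  obtain ⟨g, hg, hgU⟩ := ((mem_closure_iff_frequently.1 hh).and_eventually this).exists
  exact ⟨g, hg, hgU⟩

/-- Separating a point from countably many others takes a countable intersection of open sets. The
chosen separations of `(a, b)` and `(b, a)` may be unrelated, so each set uses both. -/
theorem exists_isGδ_pairwiseDisjoint {X : Type*} [TopologicalSpace X] [T2Space X] {D : Set X}
    (hD : D.Countable) :
    ∃ G : X → Set X, (∀ x, IsGδ (G x)) ∧ (∀ x, x ∈ G x) ∧ D.PairwiseDisjoint G := by
  have hsep : ∀ a b : X, ∃ V W : Set X, IsOpen V ∧ IsOpen W ∧ (a ≠ b → a ∈ V ∧ b ∈ W) ∧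
      Disjoint V W := by
    intro a b
    by_cases hab : a = b
    · exact ⟨∅, ∅, isOpen_empty, isOpen_empty, fun h => absurd hab h, disjoint_empty _⟩
    · obtain ⟨V, W, hV, hW, ha, hb, hd⟩ := t2_separation hab
      exact ⟨V, W, hV, hW, fun _ => ⟨ha, hb⟩, hd⟩
  choose V W hV hW hmem hd using hsep
  refine ⟨fun x => ⋂ x' ∈ D \ {x}, V x x' ∩ W x' x, fun x => ?_, fun x => ?_, ?_⟩
  · exact IsGδ.biInter (hD.mono sdiff_subset) fun x' _ => ((hV _ _).inter (hW _ _)).isGδ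
  · simp only [mem_iInter]
    intro x' hx'
    have hne : x ≠ x' := fun h => hx'.2 h.symm
    exact ⟨(hmem _ _ hne).1, (hmem _ _ hne.symm).2⟩
  · intro a ha b hb hab
    refine disjoint_left.2 fun z hza hzb => ?_
    simp only [mem_iInter] at hza hzb
    exact disjoint_left.1 (hd a b) (hza b ⟨hb, hab.symm⟩).1 (hzb a ⟨ha, hab⟩).2

theorem IsYTychonoff.isKappaFrechetUrysohn {X Y : Type*} [TopologicalSpace X]
    [AddCommGroup Y] [TopologicalSpace Y] [IsTopologicalAddGroup Y]
    [TopologicalSpace.MetrizableSpace Y] (hX : IsYTychonoff X Y) (H : AddSubgroup (X → Y))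
    (hH : stableBaireOne X Y ⊆ (H : Set (X → Y))) : IsKappaFrechetUrysohn H := by
  classical
  intro U hU h hh
  -- For trivial `Y` the space `X` need not be Hausdorff, but `H` is a single point.
  rcases subsingleton_or_nontrivial Y with hY | hY
  · obtain ⟨g, hg⟩ := closure_nonempty_iff.1 ⟨h, hh⟩
    exact ⟨fun _ => g, fun _ => hg, by rw [Subsingleton.elim g h]; exact tendsto_const_nhds⟩
  let := TopologicalSpace.metrizableSpaceMetric Y
  have := hX.t2Space
  have hstep : ∀ (n : ℕ) (F : Finset X), ∃ (g : H) (F' : Finset X),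
      (∀ x ∈ F, dist (g.1 x) (h.1 x) < 1 / ((n : ℝ) + 1)) ∧ F ⊆ F' ∧
      ∀ g' : H, EqOn g'.1 g.1 F' → g' ∈ U := by
    intro n F
    obtain ⟨g, hgU, hg⟩ := exists_mem_forall_dist_lt (H := (H : Set (X → Y))) hh F
      (Nat.one_div_pos_of_nat (α := ℝ) (n := n))
    obtain ⟨F', hF'⟩ := exists_finset_forall_eqOn_mem (H := (H : Set (X → Y))) hU hgU
    exact ⟨g, F ∪ F', hg, Finset.subset_union_left,
      fun g' hg' => hF' g' (hg'.mono (by simp))⟩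
  choose g₀ F₀ hg₀ hF₀ hU₀ using hstep
  -- `F n` controls closeness of `g n` to `h`, while `F (n + 1)` controls membership in `U`. At
  -- points of `F (n + 1)` outside `F n` closeness holds only from the next index on, which suffices
  -- for the limit.
  obtain ⟨F, hF⟩ : ∃ F : ℕ → Finset X, ∀ n, F (n + 1) = F₀ n (F n) :=
    ⟨fun n => Nat.rec ∅ F₀ n, fun _ => rfl⟩
  let g : ℕ → H := fun n => g₀ n (F n)
  have hFmono : Monotone F := monotone_nat_of_le_succ fun n => hF n ▸ hF₀ n (F n)
  have hgh : ∀ n, ∀ x ∈ F n, dist ((g n).1 x) (h.1 x) < 1 / ((n : ℝ) + 1) :=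
    fun n => hg₀ n (F n)
  have hgU : ∀ n, ∀ g' : H, EqOn g'.1 (g n).1 (F (n + 1)) → g' ∈ U :=
    fun n => hF n ▸ hU₀ n (F n)
  let D : Set X := {x | ∃ n, x ∈ F n}
  have hD : D.Countable := by
    have : D = ⋃ n, (↑(F n) : Set X) := by ext; simp [D]
    exact this ▸ countable_iUnion fun n => (F n).countable_toSet
  have hFD : ∀ {n x}, x ∈ F n → x ∈ D := fun {n x} hx => ⟨n, hx⟩
  obtain ⟨G, hG, hxG, hGd⟩ := exists_isGδ_pairwiseDisjoint hD
  choose Z hZG hxZ hZ using fun (n : ℕ) (x : X) =>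
    hX.exists_indicator_mem_stableBaireOne (hG x) (hxG x) ((g n).1 x - h.1 x)
  let b : ℕ → H := fun n =>
    ∑ x ∈ F (n + 1), ⟨(Z n x).indicator fun _ => (g n).1 x - h.1 x, hH (hZ n x)⟩
  have hb : ∀ n z, (b n).1 z =
      ∑ x ∈ F (n + 1), (Z n x).indicator (fun _ => (g n).1 x - h.1 x) z := by
    intro n z
    simp [b]
  -- on `G x` only the summand belonging to `x` survives
  have hbG : ∀ n, ∀ x ∈ D, ∀ z ∈ G x, (b n).1 z =
      if x ∈ F (n + 1) then (Z n x).indicator (fun _ => (g n).1 x - h.1 x) z else 0 := by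
    intro n x hx z hz
    rw [hb, ← Finset.sum_ite_eq' (F (n + 1)) x
      fun x => (Z n x).indicator (fun _ => (g n).1 x - h.1 x) z]
    refine Finset.sum_congr rfl fun x' hx' => ?_
    split_ifs with hxx
    · rw [hxx]
    · exact indicator_of_notMem
        (fun hz' => disjoint_left.1 (hGd (hFD hx') hx hxx) (hZG n x' hz') hz) _
  refine ⟨fun n => h + b n, fun n => hgU n _ fun x hx => ?_, ?_⟩
  · have hx' : x ∈ F (n + 1) := hx
    have := hbG n x (hFD hx') x (hxG x)
    rw [if_pos hx', indicator_of_mem (hxZ n x)] at this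
    change h.1 x + (b n).1 x = _
    rw [this, add_sub_cancel]
  · rw [tendsto_subtype_rng, tendsto_pi_nhds]
    intro z
    suffices hz : Tendsto (fun n => (b n).1 z) atTop (𝓝 0) by
      simpa using (tendsto_const_nhds (x := h.1 z)).add hz
    by_cases hzD : ∃ x ∈ D, z ∈ G x
    · obtain ⟨x, hx, hzx⟩ := hzD
      have ⟨N, hN⟩ := hx
      have hg : Tendsto (fun n => (g n).1 x) atTop (𝓝 (h.1 x)) := by
        rw [tendsto_iff_dist_tendsto_zero]
        refine squeeze_zero' (Eventually.of_forall fun _ => dist_nonneg) ?_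
          tendsto_one_div_add_atTop_nhds_zero_nat
        filter_upwards [eventually_ge_atTop N] with n hn
        exact (hgh n x (hFmono hn hN)).le
      have hsub : Tendsto (fun n => (g n).1 x - h.1 x) atTop (𝓝 0) := by
        simpa using hg.sub_const (h.1 x)
      rw [tendsto_def] at hsub ⊢
      intro s hs
      filter_upwards [hsub s hs] with n hn
      rw [mem_preimage, hbG n x hx z hzx]
      by_cases hxn : x ∈ F (n + 1) <;> by_cases hzn : z ∈ Z n x
      · simpa [hxn, hzn] using hn
      all_goals simpa [hxn, hzn] using mem_of_mem_nhds hs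
    · have : ∀ n, (b n).1 z = 0 := fun n => by
        rw [hb]
        exact Finset.sum_eq_zero fun x hx =>
          indicator_of_notMem (fun hz => hzD ⟨x, hFD hx, hZG n x hz⟩) _
      simp only [this]
      exact tendsto_const_nhds

/-! ### Baire classes as subgroups -/

theorem mem_baireClass_zero {X Y : Type*} [TopologicalSpace X] [TopologicalSpace Y] {f : X → Y} :
    f ∈ baireClass X Y 0 ↔ Continuous f := by
  rw [baireClass]; simp

theorem mem_baireClass_of_ne_zero {X Y : Type*} [TopologicalSpace X] [TopologicalSpace Y]
    {α : Ordinal.{0}} (hα : α ≠ 0) {f : X → Y} :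
    f ∈ baireClass X Y α ↔ ∃ u : ℕ → X → Y, (∀ n, ∃ β < α, u n ∈ baireClass X Y β) ∧
      ∀ x : X, Tendsto (fun n => u n x) atTop (𝓝 (f x)) := by
  rw [baireClass]; simp [hα]

theorem baireClass_mono {X Y : Type*} [TopologicalSpace X] [TopologicalSpace Y] :
    Monotone (baireClass X Y) := by
  intro β α h f hf
  rcases h.eq_or_lt with rfl | hlt
  · exact hf
  · exact (mem_baireClass_of_ne_zero (bot_le.trans_lt hlt).ne').2
      ⟨fun _ => f, fun _ => ⟨β, hlt, hf⟩, fun _ => tendsto_const_nhds⟩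

theorem stableBaireOne_subset_baireClass {X Y : Type*} [TopologicalSpace X] [TopologicalSpace Y]
    {α : Ordinal.{0}} (hα : 1 ≤ α) : stableBaireOne X Y ⊆ baireClass X Y α := by
  rintro f ⟨u, hu, huf⟩
  have h0 : 0 < α := zero_lt_one.trans_le hα
  refine (mem_baireClass_of_ne_zero h0.ne').2
    ⟨u, fun n => ⟨0, h0, mem_baireClass_zero.2 (hu n)⟩, fun x => ?_⟩
  refine tendsto_const_nhds.congr' ?_
  have := (huf x).compl_mem_cofinite
  rw [Nat.cofinite_eq_atTop] at this
  filter_upwards [this] with n hn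
  exact (not_not.1 hn).symm

/-- The `n`-th terms of the two approximating sequences may have different orders; monotonicity
moves both to the larger one, still below `α`, where induction applies. -/
theorem sub_mem_baireClass {X Y : Type*} [TopologicalSpace X] [AddGroup Y]
    [TopologicalSpace Y] [IsTopologicalAddGroup Y] (α : Ordinal.{0}) :
    ∀ f ∈ baireClass X Y α, ∀ g ∈ baireClass X Y α, f - g ∈ baireClass X Y α := by
  induction α using WellFoundedLT.induction with
  | ind α ih =>
  intro f hf g hg
  rcases eq_or_ne α 0 with rfl | hα
  · rw [mem_baireClass_zero] at *
    exact hf.sub hg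
  · rw [mem_baireClass_of_ne_zero hα] at *
    obtain ⟨u, hu, huf⟩ := hf
    obtain ⟨v, hv, hvg⟩ := hg
    refine ⟨fun n => u n - v n, fun n => ?_, fun x => (huf x).sub (hvg x)⟩
    obtain ⟨β, hβ, hβu⟩ := hu n
    obtain ⟨γ, hγ, hγv⟩ := hv n
    exact ⟨max β γ, max_lt hβ hγ, ih _ (max_lt hβ hγ) _ (baireClass_mono (le_max_left _ _) hβu) _
      (baireClass_mono (le_max_right _ _) hγv)⟩

theorem continuous_mem_baireClass {X Y : Type*} [TopologicalSpace X] [TopologicalSpace Y]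
    (α : Ordinal.{0}) {f : X → Y} (hf : Continuous f) : f ∈ baireClass X Y α :=
  baireClass_mono bot_le (mem_baireClass_zero.2 hf)

/-- The Baire class of order `α` as a subgroup of `X → Y`. -/
def baireClassAddSubgroup (X Y : Type*) [TopologicalSpace X] [AddGroup Y]
    [TopologicalSpace Y] [IsTopologicalAddGroup Y] (α : Ordinal.{0}) : AddSubgroup (X → Y) :=
  AddSubgroup.ofSub (baireClass X Y α) ⟨0, continuous_mem_baireClass α continuous_const⟩
    fun f hf g hg => by simpa [sub_eq_add_neg] using sub_mem_baireClass α f hf g hg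

theorem theoremt {X : Type*} {Y : Type*} [TopologicalSpace X]
    [AddCommGroup Y] [TopologicalSpace Y] [IsTopologicalAddGroup Y]
    [TopologicalSpace.MetrizableSpace Y] (hX : IsYTychonoff X Y) :
    (∀ H : AddSubgroup (X → Y), stableBaireOne X Y ⊆ (H : Set (X → Y)) →
      IsKappaFrechetUrysohn H ∧ IsAscoli H) ∧
    (∀ α : Ordinal.{0}, 1 ≤ α → α.card ≤ Cardinal.aleph0 →
      IsKappaFrechetUrysohn (baireClass X Y α) ∧ IsAscoli (baireClass X Y α)) := by
  have main : ∀ H : AddSubgroup (X → Y), stableBaireOne X Y ⊆ (H : Set (X → Y)) →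
      IsKappaFrechetUrysohn H ∧ IsAscoli H := by
    intro H hH
    let := TopologicalSpace.metrizableSpaceMetric Y
    have hK := hX.isKappaFrechetUrysohn H hH
    exact ⟨hK, hK.isAscoli⟩
  exact ⟨main, fun α hα _ =>
    main (baireClassAddSubgroup X Y α) (stableBaireOne_subset_baireClass hα)⟩
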